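/- Let $G=(V,E)$ be a finite simple graph with one qubit at each vertex; write $N=|V|$, and let $X_i,Z_i$ be the Pauli operators on qubit $i$. The graph state of $G$ is $$|G\rangle=\prod_{\{i,j\}\in E}\mathrm{CZ}^{\{i,j\}}\,|+\rangle^{\otimes N},$$ where $|+\rangle=(|0\rangle+|1\rangle)/\sqrt2$ and $\mathrm{CZ}^{\{i,j\}}$ is the controlled-$Z$ gate on the qubits $i,j$. Its stabilizers are $S_i=X_i\prod_{j\in N_i}Z_j$ for $i\in V$, where $N_i$ is the set of neighbours of $i$. Let $V=V_1\sqcup\dots\sqcup V_k$ be a proper $k$-colouring of $G$ (no edge joins two vertices of the same $V_l$), and put $P_l=\prod_{i\in V_l}\frac{S_i+\mathbb I}{2}$. Let $\mathcal P=\{A_1,\dots,A_m\}$ be a partition of $V$ into $m\ge2$ nonempty sets. A bipartition $\{A,\bar A\}$ of $\mathcal P$ consists of a union $A$ of some of the $A_i$ with $\emptyset\ne A\ne V$, and $\bar A=V\setminus A$. A pure state is $\mathcal P$-fully separable if it has the form $\bigotimes_{i=1}^m|\Phi_{A_i}\rangle$, and $\mathcal P$-bi-separable if it has the form $|\Phi_A\rangle\otimes|\Phi_{\bar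 A}\rangle$ for some bipartition $\{A,\bar A\}$ of $\mathcal P$. A mixed state $\rho$ is $\mathcal P$-fully separable (respectively $\mathcal P$-bi-separable) if $\rho=\sum_i p_i|\Psi^i\rangle\langle\Psi^i|$ is a finite convex mixture of $\mathcal P$-fully separable (respectively $\mathcal P$-bi-separable) pure states, where in the bi-separable case different $|\Psi^i\rangle$ may use different bipartitions. For a bipartition $\{A,\bar A\}$ let $\rho_A=\mathrm{Tr}_{\bar A}|G\rangle\langle G|$, and let $S(\rho_A)=-\mathrm{Tr}[\rho_A\log_2\rho_A]$ be its von Neumann entropy. Define $$W_f=\Bigl(k-1+\min_{\{A,\bar A\}}2^{-S(\rho_A)}\Bigr)\mathbb I-\sum_{l=1}^kP_l,\qquad W_b=\Bigl(k-1+\max_{\{A,\bar A\}}2^{-S(\rho_A)}\Bigr)\mathbb I-\sum_{l=1}^kP_l,$$ where the minimum and the maximum are over all bipartitions $\{A,\bar A\}$ of $\mathcal P$. Then $\mathrm{Tr}(W_f\,\rho)\ge0$ for every $\mathcal P$-fully separable state $\rho$, and $\mathrm{Tr}(W_b\,\rho)\ge0$ for every $\mathcal P$-bi-separable state $\rho$.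 Moreover, if $G$ is connected, then $\mathrm{Tr}(W_f|G\rangle\langle G|)<0$ and $\mathrm{Tr}(W_b|G\rangle\langle G|)<0$, so that $W_f$ witnesses non-$\mathcal P$-full-separability and $W_b$ witnesses $\mathcal P$-genuine entanglement (that is, not being $\mathcal P$-bi-separable). -/

import Mathlib

open scoped ComplexOrder

noncomputable section

namespace GraphWitness

/-- The computational basis states of a family of qubits labelled by `V`. -/
abbrev Config (V : Type*) := V → Fin 2

/-- State vectors of qubits labelled by `V`, in the computational basis. -/
abbrev QVec (V : Type*) := Config V → ℂ

/-- Operators on the state space of qubits labelled by `V`, in the computational basis. -/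
abbrev QOp (V : Type*) := Matrix (Config V) (Config V) ℂ

/-- The operator `|ψ⟩⟨ψ|`. -/
def ketBra {V : Type*} (ψ : QVec V) : QOp V := Matrix.vecMulVec ψ (star ψ)

/-- The Pauli matrix `X`. -/
def pauliX : Matrix (Fin 2) (Fin 2) ℂ := !![0, 1; 1, 0]

/-- The Pauli matrix `Z`. -/
def pauliZ : Matrix (Fin 2) (Fin 2) ℂ := !![1, 0; 0, -1]

section Graph

variable {V : Type*} [Fintype V] [DecidableEq V]

/-- The tensor product `⨂ v, M v` of single-qubit operators. -/
def tensorOp (M : V → Matrix (Fin 2) (Fin 2) ℂ) : QOp V :=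
  Matrix.of fun x y => ∏ v, M v (x v) (y v)

/-- The product state `|+⟩^{⊗ V}` with `|+⟩ = (|0⟩ + |1⟩) / √2`. -/
def plusState (V : Type*) [Fintype V] : QVec V :=
  fun _ => ∏ _v : V, ((1 / Real.sqrt 2 : ℝ) : ℂ)

/-- The controlled-`Z` gate on the two qubits of the edge `e`: it is diagonal, and it multiplies a
basis state by `-1` exactly when both qubits of `e` are in the state `1`. -/
def czGate (e : Sym2 V) : QOp V :=
  Matrix.diagonal fun x => if ∀ v ∈ e, x v = 1 then -1 else 1

theorem czGate_commute (e f : Sym2 V) : Commute (czGate e) (czGate f) := by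
  simp [Commute, SemiconjBy, czGate, Matrix.diagonal_mul_diagonal, mul_comm]

theorem czGate_pairwise (s : Set (Sym2 V)) :
    s.Pairwise (Function.onFun Commute (czGate (V := V))) :=
  fun e _ f _ _ => czGate_commute e f

variable (G : SimpleGraph V) [DecidableRel G.Adj]

/-- The graph state `|G⟩ = ∏_{e ∈ E} CZ_e |+⟩^{⊗ V}`. -/
def graphState : QVec V :=
  (G.edgeFinset.noncommProd czGate (czGate_pairwise _)).mulVec (plusState V)

/-- The single-qubit factor at the qubit `v` of the stabilizer `S_i`. -/
def stabilizerFactor (i v : V) : Matrix (Fin 2) (Fin 2) ℂ :=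
  if v = i then pauliX else if G.Adj i v then pauliZ else 1

/-- The stabilizer `S_i = X_i ⨂_{j ∈ N_i} Z_j`, with identities on the other qubits. -/
def stabilizer (i : V) : QOp V := tensorOp (stabilizerFactor G i)

theorem tensorOp_mul (M N : V → Matrix (Fin 2) (Fin 2) ℂ) :
    tensorOp M * tensorOp N = tensorOp fun v => M v * N v := by
  ext x y
  simp only [tensorOp, Matrix.mul_apply, Matrix.of_apply, ← Finset.prod_mul_distrib]
  exact (Fintype.prod_sum fun v s => M v (x v) s * N v s (y v)).symm

theorem stabilizer_commute (i j : V) : Commute (stabilizer G i) (stabilizer G j) := by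
  by_cases hij : i = j
  · rw [hij]
  have key : ∀ v, stabilizerFactor G i v * stabilizerFactor G j v =
      ((if v = i then (if G.Adj i j then (-1 : ℂ) else 1) else 1) *
        (if v = j then (if G.Adj i j then (-1 : ℂ) else 1) else 1)) •
        (stabilizerFactor G j v * stabilizerFactor G i v) := by
    intro v
    have hxz : pauliX * pauliZ = -(pauliZ * pauliX) := by
      ext a b; fin_cases a <;> fin_cases b <;> simp [pauliX, pauliZ]
    by_cases h1 : v = i
    · subst h1
      by_cases h2 : G.Adj v j
      · simp [stabilizerFactor, hij, h2, h2.symm, hxz]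
      · simp [stabilizerFactor, hij, h2, G.adj_comm j v]
    · by_cases h2 : v = j
      · subst h2
        by_cases h3 : G.Adj i v
        · simp [stabilizerFactor, h1, h3, hxz]
        · simp [stabilizerFactor, h1, h3]
      · simp only [stabilizerFactor, h1, h2, if_false, one_mul, one_smul]
        split_ifs <;> simp
  simp only [Commute, SemiconjBy, stabilizer, tensorOp_mul]
  ext x y
  simp only [tensorOp, Matrix.of_apply, key, Matrix.smul_apply, smul_eq_mul,
    Finset.prod_mul_distrib, Finset.prod_ite_eq', Finset.mem_univ, if_true]
  split_ifs <;> simp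

theorem stabilizer_projector_commute (i j : V) :
    Commute ((2⁻¹ : ℂ) • (stabilizer G i + 1)) ((2⁻¹ : ℂ) • (stabilizer G j + 1)) :=
  (((stabilizer_commute G i j).add_right (Commute.one_right _)).add_left
    (Commute.one_left _)).smul_left _ |>.smul_right _

theorem stabilizer_projector_pairwise (s : Set V) :
    s.Pairwise (Function.onFun Commute fun i => (2⁻¹ : ℂ) • (stabilizer G i + 1)) :=
  fun i _ j _ _ => stabilizer_projector_commute G i j

/-- The stabilizer projector `P_l = ∏_{i ∈ V_l} (S_i + I) / 2` of the colour class `V_l`. -/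
def colorProjector {k : ℕ} (C : G.Coloring (Fin k)) (l : Fin k) : QOp V :=
  (Finset.univ.filter fun i => C i = l).noncommProd
    (fun i => (2⁻¹ : ℂ) • (stabilizer G i + 1))
    (stabilizer_projector_pairwise G _)

/-- The operator `(k - 1 + c) I - ∑_l P_l`. -/
def witness {k : ℕ} (C : G.Coloring (Fin k)) (c : ℝ) : QOp V :=
  ((k : ℝ) - 1 + c) • (1 : QOp V) - ∑ l, colorProjector G C l

end Graph

section Entropy

variable {V : Type*} [Fintype V] [DecidableEq V]

/-- The basis state of all qubits which agrees with `a` on `A` and with `b` outside `A`. -/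
def glue (A : Finset V) (a : Config {v // v ∈ A}) (b : Config {v // v ∉ A}) : Config V :=
  fun v => if h : v ∈ A then a ⟨v, h⟩ else b ⟨v, h⟩

/-- The reduced operator on the qubits in `A`: the partial trace over the qubits outside `A`. -/
def reduced (A : Finset V) (ρ : QOp V) : QOp {v // v ∈ A} :=
  Matrix.of fun a a' => ∑ b : Config {v // v ∉ A}, ρ (glue A a b) (glue A a' b)

/-- The von Neumann entropy `S(ρ) = -Tr[ρ log₂ ρ]`, with the logarithm of a Hermitian matrix
given by the functional calculus (and the convention `0 log 0 = 0`). -/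
def vonNeumannEntropy {n : Type*} [Fintype n] [DecidableEq n] (ρ : Matrix n n ℂ) : ℝ :=
  -(ρ * cfc (Real.logb 2) ρ).trace.re

end Entropy

section Separability

variable {V : Type*} [Fintype V] [DecidableEq V]

/-- The unit vectors. -/
def IsPureState (ψ : QVec V) : Prop := ∑ x, ‖ψ x‖ ^ 2 = 1

/-- `ρ` is a convex mixture `∑ p_i |ψ_i⟩⟨ψ_i|` of pure states `ψ_i` in the set `S`. -/
def IsMixtureOf (S : Set (QVec V)) (ρ : QOp V) : Prop :=
  ∃ (n : ℕ) (p : Fin n → ℝ) (ψ : Fin n → QVec V),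
    (∀ i, 0 ≤ p i) ∧ ∑ i, p i = 1 ∧ (∀ i, ψ i ∈ S) ∧ ρ = ∑ i, p i • ketBra (ψ i)

variable (P : Finpartition (Finset.univ : Finset V))

/-- The sides `A` of the subsystem bipartitions `{A, Aᶜ}` of the partition `P`: the unions of parts
of `P` which are neither empty nor everything. -/
def bipartitionSides : Finset (Finset V) :=
  Finset.univ.filter fun A => A ≠ ∅ ∧ A ≠ Finset.univ ∧ ∃ T ⊆ P.parts, T.biUnion id = A

theorem bipartitionSides_nonempty (hP : 2 ≤ P.parts.card) : (bipartitionSides P).Nonempty := by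
  obtain ⟨A, hA, B, hB, hAB⟩ := Finset.one_lt_card.mp hP
  refine ⟨A, Finset.mem_filter.mpr ⟨Finset.mem_univ _, P.ne_bot hA, ?_, {A}, ?_, ?_⟩⟩
  · rintro rfl
    have hd : Disjoint Finset.univ B := P.disjoint hA hB hAB
    exact P.ne_bot hB (disjoint_self.mp (hd.mono_left (Finset.subset_univ B)))
  · simpa using hA
  · simp

/-- The `P`-fully separable pure states `⨂_i |Φ_{A_i}⟩`. -/
def fullySeparablePure : Set (QVec V) :=
  {ψ | IsPureState ψ ∧ ∃ φ : (A : {A // A ∈ P.parts}) → QVec {v // v ∈ A.1},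
    ∀ x, ψ x = ∏ A, φ A fun v => x v}

/-- The `P`-bi-separable pure states `|Φ_A⟩ ⊗ |Φ_{Aᶜ}⟩`. -/
def biSeparablePure : Set (QVec V) :=
  {ψ | IsPureState ψ ∧ ∃ A ∈ bipartitionSides P,
    ∃ (φ : QVec {v // v ∈ A}) (χ : QVec {v // v ∉ A}),
      ∀ x, ψ x = φ (fun v => x v) * χ (fun v => x v)}

/-- The `P`-fully separable mixed states. -/
def IsFullySeparable (ρ : QOp V) : Prop := IsMixtureOf (fullySeparablePure P) ρ

/-- The `P`-bi-separable mixed states. -/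
def IsBiSeparable (ρ : QOp V) : Prop := IsMixtureOf (biSeparablePure P) ρ

variable (G : SimpleGraph V) [DecidableRel G.Adj]

/-- The number `2^{-S(ρ_A)}` for the reduced density matrix `ρ_A` of the graph state. -/
def entropyWeight (A : Finset V) : ℝ :=
  (2 : ℝ) ^ (-vonNeumannEntropy (reduced A (ketBra (graphState G))))

/-- The minimum of `2^{-S(ρ_A)}` over the subsystem bipartitions `{A, Aᶜ}` of `P`. -/
def minWeight (hP : 2 ≤ P.parts.card) : ℝ :=
  (bipartitionSides P).inf' (bipartitionSides_nonempty P hP) (entropyWeight G)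

/-- The maximum of `2^{-S(ρ_A)}` over the subsystem bipartitions `{A, Aᶜ}` of `P`. -/
def maxWeight (hP : 2 ≤ P.parts.card) : ℝ :=
  (bipartitionSides P).sup' (bipartitionSides_nonempty P hP) (entropyWeight G)

end Separability

end GraphWitness

end

/-!
Conjugation by the controlled-`Z` gates turns `(S_i + I) / 2` into `|+⟩⟨+|` on the qubit `i`. So the
products of the `(S_i + I) / 2` over sets `S` of qubits are commuting projectors `Q_S`
(`stabilizerProjector`) with `Q_S Q_T = Q_{S ∪ T}`, with `P_l = Q_{V_l}` and `Q_V = |G⟩⟨G|`. Since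
`(1 - Q) + (1 - R) - (1 - Q R) = (1 - Q) (1 - R)` is positive semidefinite for commuting projectors,
`∑ l, (1 - P_l) ≥ 1 - |G⟩⟨G|` (`posSemidef_sum_one_sub_stabilizerProjector`). Hence the witness with
constant `c` dominates `c I - |G⟩⟨G|`, and it is nonnegative on mixtures of pure states `ψ` with
`|⟨G|ψ⟩|² ≤ c`.

The amplitudes of `|G⟩` are, up to normalization, the exponentials of a quadratic form over the field
with two elements (`phase_add_add`). Across a bipartition `{A, Aᶜ}` they therefore factorize up to a
bicharacter (`crossChar`), and orthogonality of characters gives `ρ_A² = c ρ_A` with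
`c = |K| / 2 ^ |A|`, where `K` is the kernel of the bicharacter (`reduced_graphState_mul_self`). As
`ρ_A` has trace one, `2 ^ (-S(ρ_A)) = c` (`two_rpow_neg_vonNeumannEntropy`), and Cauchy-Schwarz together
with `ρ_A ≤ c I` bounds `|⟨G|φ ⊗ χ⟩|²` by `c` (`norm_overlap_sq_le`). A bi-separable pure state satisfies
this bound for one bipartition, a fully separable one for all of them; this is where the maximum and
the minimum come from.

Finally every `P_l` fixes `|G⟩`, so the witness with constant `c` has expectation value `c - 1` in `|G⟩`.
If `G` is connected, an edge leaves `A`, the bicharacter is nontrivial, `K` is a proper subgroup, and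
`c < 1` (`entropyWeight_lt_one`).
-/

noncomputable section

namespace GraphWitness

/-! ### The phase of the graph state -/

section Phase

variable {V : Type*} [Fintype V] [DecidableEq V] (G : SimpleGraph V) [DecidableRel G.Adj]

/-- The diagonal entry of the controlled-`Z` gate on `e` at the basis state `x`. -/
def edgeSign (e : Sym2 V) (x : Config V) : ℂ := if ∀ v ∈ e, x v = 1 then -1 else 1

/-- The sign of the amplitude of the graph state at the basis state `x`: `-1` to the number of
edges of `G` both of whose ends are in the state `1`. -/
def phase (x : Config V) : ℂ := ∏ e ∈ G.edgeFinset, edgeSign e x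

theorem edgeSign_mul_self (e : Sym2 V) (x : Config V) : edgeSign e x * edgeSign e x = 1 := by
  unfold edgeSign; split_ifs <;> simp

theorem star_edgeSign (e : Sym2 V) (x : Config V) : star (edgeSign e x) = edgeSign e x := by
  unfold edgeSign; split_ifs <;> simp

theorem phase_mul_self (x : Config V) : phase G x * phase G x = 1 := by
  simp [phase, ← Finset.prod_mul_distrib, edgeSign_mul_self]

theorem star_phase (x : Config V) : star (phase G x) = phase G x := by
  simp [phase, star_prod, star_edgeSign]

theorem phase_zero : phase G 0 = 1 := by
  refine Finset.prod_eq_one fun e _ => ?_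
  induction e with | _ i j => exact if_neg fun h => by simpa using h i (Sym2.mem_mk_left i j)

theorem edgeSign_add_add (e : Sym2 V) (x y z : Config V) :
    edgeSign e (x + y + z) * edgeSign e x * edgeSign e y * edgeSign e z =
      edgeSign e (x + y) * edgeSign e (x + z) * edgeSign e (y + z) := by
  induction e with | _ i j =>
  simp only [edgeSign, Sym2.mem_iff, forall_eq_or_imp, forall_eq, Pi.add_apply]
  -- The claim involves six bits and integer signs only, so it can be decided.
  generalize x i = a, x j = b, y i = c, y j = d, z i = e, z j = f
  have key : ∀ a b c d e f : Fin 2,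
      (if a + c + e = 1 ∧ b + d + f = 1 then -1 else 1 : ℤ) * (if a = 1 ∧ b = 1 then -1 else 1) *
        (if c = 1 ∧ d = 1 then -1 else 1) * (if e = 1 ∧ f = 1 then -1 else 1) =
      (if a + c = 1 ∧ b + d = 1 then -1 else 1) * (if a + e = 1 ∧ b + f = 1 then -1 else 1) *
        (if c + e = 1 ∧ d + f = 1 then -1 else 1) := by decide
  exact_mod_cast congrArg (Int.cast : ℤ → ℂ) (key a b c d e f)

/-- The phase is the exponential of a quadratic form over the field with two elements: its third
multiplicative difference is trivial. -/
theorem phase_add_add (x y z : Config V) :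
    phase G (x + y + z) * phase G x * phase G y * phase G z =
      phase G (x + y) * phase G (x + z) * phase G (y + z) := by
  simp only [phase, ← Finset.prod_mul_distrib, edgeSign_add_add]

theorem noncommProd_czGate :
    G.edgeFinset.noncommProd czGate (czGate_pairwise _) = Matrix.diagonal (phase G) := by
  have key : ∀ s : Finset (Sym2 V), s.noncommProd czGate (czGate_pairwise _) =
      Matrix.diagonal fun x => ∏ e ∈ s, edgeSign e x := by
    intro s
    induction s using Finset.induction_on with
    | empty => simp
    | insert e s he ih =>
      rw [Finset.noncommProd_insert_of_notMem _ _ _ _ he, ih, czGate, Matrix.diagonal_mul_diagonal]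
      simp [Finset.prod_insert he, edgeSign]
  exact key _

theorem graphState_apply (x : Config V) :
    graphState G x = phase G x * ((1 / Real.sqrt 2 : ℝ) : ℂ) ^ Fintype.card V := by
  simp [graphState, noncommProd_czGate, Matrix.mulVec_diagonal, plusState]

theorem graphState_mul_star (x y : Config V) :
    graphState G x * star (graphState G y) =
      phase G x * phase G y * (2⁻¹ : ℂ) ^ Fintype.card V := by
  have h : (((1 / Real.sqrt 2 : ℝ) : ℂ)) * ((1 / Real.sqrt 2 : ℝ) : ℂ) = 2⁻¹ := by
    rw [← Complex.ofReal_mul, div_mul_div_comm, Real.mul_self_sqrt (by norm_num)]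
    norm_num
  have hs : star ((1 / Real.sqrt 2 : ℝ) : ℂ) = ((1 / Real.sqrt 2 : ℝ) : ℂ) :=
    Complex.conj_ofReal _
  rw [graphState_apply, graphState_apply, star_mul', star_phase, star_pow, hs, ← h, mul_pow]
  ring

/-- Flipping the qubit `i` changes the phase by the `Z`-eigenvalues of the neighbours of `i`. -/
theorem phase_mul_phase_flip (i : V) (x y : Config V) (hi : x i ≠ y i)
    (h : ∀ v, v ≠ i → x v = y v) :
    phase G x * phase G y = ∏ j ∈ G.neighborFinset i, if x j = 1 then (-1 : ℂ) else 1 := by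
  rw [phase, phase, ← Finset.prod_mul_distrib]
  symm
  refine Finset.prod_of_injOn (fun j => s(i, j)) ?_ ?_ ?_ ?_
  · intro a _ b _ hab
    exact Sym2.congr_right.mp hab
  · intro j hj
    simpa using hj
  · intro e he hne
    have hie : i ∉ e := by
      intro hie
      obtain ⟨j, rfl⟩ := Sym2.mem_iff_exists.mp hie
      exact hne ⟨j, by simpa using he, rfl⟩
    have : edgeSign e y = edgeSign e x := by
      unfold edgeSign
      congr 1
      refine propext (forall₂_congr fun v hv => ?_)
      rw [h v (fun hvi => hie (hvi ▸ hv))]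
    rw [this, edgeSign_mul_self]
  · intro j hj
    have hji : j ≠ i := by
      rintro rfl
      simp at hj
    simp only [edgeSign, Sym2.mem_iff, forall_eq_or_imp, forall_eq, ← h j hji]
    generalize x i = a, y i = b at hi
    by_cases hx : x j = 1
    · fin_cases a <;> fin_cases b <;> simp_all
    · simp [hx]

end Phase

/-! ### Stabilizer projectors -/

section Projectors

variable {V : Type*} [Fintype V] [DecidableEq V] (G : SimpleGraph V) [DecidableRel G.Adj]

/-- The single-qubit projector `|+⟩⟨+|`. -/
def plusProj : Matrix (Fin 2) (Fin 2) ℂ := Matrix.of fun _ _ => 2⁻¹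

theorem plusProj_mul_self : plusProj * plusProj = plusProj := by
  ext a b
  simp only [plusProj, Matrix.mul_apply, Matrix.of_apply, Fin.sum_univ_two]
  norm_num

/-- The projector `∏_{i ∈ S} (S_i + I) / 2`, written as the conjugate by the controlled-`Z` gates of
the operator that is `|+⟩⟨+|` on the qubits in `S` and the identity on the others. -/
def stabilizerProjector (S : Finset V) : QOp V :=
  Matrix.diagonal (phase G) * (tensorOp fun v => if v ∈ S then plusProj else 1) *
    Matrix.diagonal (phase G)

theorem stabilizerProjector_apply (S : Finset V) (x y : Config V) :
    stabilizerProjector G S x y =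
      phase G x * (∏ v, (if v ∈ S then plusProj else 1) (x v) (y v)) * phase G y := by
  simp [stabilizerProjector, Matrix.mul_diagonal, Matrix.diagonal_mul, tensorOp]

theorem tensorOp_one {V : Type*} [Fintype V] : tensorOp (fun _ : V => 1) = 1 := by
  ext x y
  simp only [tensorOp, Matrix.of_apply, Matrix.one_apply, Finset.prod_ite_zero,
    Finset.prod_const_one, funext_iff, Finset.mem_univ, true_imp_iff]

theorem diagonal_phase_mul_self :
    Matrix.diagonal (phase G) * Matrix.diagonal (phase G) = 1 := by
  simp only [Matrix.diagonal_mul_diagonal, phase_mul_self, Matrix.diagonal_one]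

theorem stabilizerProjector_empty : stabilizerProjector G ∅ = 1 := by
  simp only [stabilizerProjector, Finset.notMem_empty, if_false, tensorOp_one, mul_one,
    diagonal_phase_mul_self]

theorem stabilizerProjector_mul (S T : Finset V) :
    stabilizerProjector G S * stabilizerProjector G T = stabilizerProjector G (S ∪ T) := by
  have h : (tensorOp fun v => if v ∈ S then plusProj else 1) *
      (tensorOp fun v => if v ∈ T then plusProj else 1) =
      tensorOp fun v => if v ∈ S ∪ T then plusProj else 1 := by
    rw [tensorOp_mul]
    congr 1
    ext1 v
    by_cases hS : v ∈ S <;> by_cases hT : v ∈ T <;> simp [hS, hT, plusProj_mul_self]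
  simp only [stabilizerProjector, ← h]
  simp only [Matrix.mul_assoc]
  congr 2
  rw [← Matrix.mul_assoc (Matrix.diagonal _), diagonal_phase_mul_self, Matrix.one_mul]

theorem isHermitian_stabilizerProjector (S : Finset V) :
    (stabilizerProjector G S).IsHermitian := by
  ext x y
  rw [Matrix.conjTranspose_apply, stabilizerProjector_apply, stabilizerProjector_apply]
  rw [star_mul', star_mul', star_phase, star_phase, star_prod]
  have : ∀ v, star ((if v ∈ S then plusProj else 1) (y v) (x v)) =
      (if v ∈ S then plusProj else 1) (x v) (y v) := by
    intro v
    split_ifs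
    · simp [plusProj]
    · simp [Matrix.one_apply, eq_comm, apply_ite]
  simp only [this]
  ring

theorem posSemidef_of_isHermitian_of_mul_self {n : Type*} [Fintype n] [DecidableEq n]
    {Q : Matrix n n ℂ} (hQ : Q.IsHermitian) (h : Q * Q = Q) : Q.PosSemidef := by
  have := Matrix.posSemidef_conjTranspose_mul_self Q
  rwa [hQ.eq, h] at this

theorem stabilizerProjector_univ :
    stabilizerProjector G Finset.univ = ketBra (graphState G) := by
  ext x y
  rw [stabilizerProjector_apply, ketBra, Matrix.vecMulVec_apply, Pi.star_apply,
    graphState_mul_star]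
  simp [plusProj]
  ring

theorem stabilizerProjector_singleton (i : V) :
    stabilizerProjector G {i} = (2⁻¹ : ℂ) • (stabilizer G i + 1) := by
  ext x y
  rw [stabilizerProjector_apply, Matrix.smul_apply, Matrix.add_apply, smul_eq_mul, stabilizer,
    tensorOp, Matrix.of_apply, Fintype.prod_eq_mul_prod_compl i,
    Fintype.prod_eq_mul_prod_compl i]
  by_cases h : ∀ v, v ≠ i → x v = y v
  · have hl : ∏ v ∈ {i}ᶜ, (if v ∈ ({i} : Finset V) then plusProj else 1) (x v) (y v) = 1 := by
      refine Finset.prod_eq_one fun v hv => ?_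
      have hv : v ≠ i := by simpa using hv
      rw [if_neg (by simpa using hv), h v hv, Matrix.one_apply_eq]
    rw [hl]
    by_cases hi : x i = y i
    · have hxy : x = y := by
        ext1 v
        by_cases hv : v = i
        · rw [hv, hi]
        · exact h v hv
      subst hxy
      have hX : pauliX (x i) (x i) = 0 := by
        generalize x i = a
        fin_cases a <;> simp [pauliX]
      have := phase_mul_self G x
      simp only [Finset.mem_singleton, if_true, plusProj, Matrix.of_apply, stabilizerFactor, hX,
        Matrix.one_apply_eq]
      linear_combination 2⁻¹ * this
    · have hxy : x ≠ y := fun hxy => hi (congrFun hxy i)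
      have hX : pauliX (x i) (y i) = 1 := by
        revert hi
        generalize x i = a, y i = b
        fin_cases a <;> fin_cases b <;> simp [pauliX]
      have hr : ∏ v ∈ {i}ᶜ, stabilizerFactor G i v (x v) (y v) =
          ∏ j ∈ G.neighborFinset i, if x j = 1 then (-1 : ℂ) else 1 := by
        symm
        refine Finset.prod_subset_one_on_sdiff ?_ ?_ ?_
        · intro j hj
          have : G.Adj i j := by simpa using hj
          simpa using this.ne'
        · intro v hv
          have hv' : v ≠ i ∧ ¬ G.Adj i v := by simpa using hv
          rw [stabilizerFactor, if_neg hv'.1, if_neg hv'.2, h v hv'.1, Matrix.one_apply_eq]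
        · intro v hv
          have hv' : G.Adj i v := by simpa using hv
          simp only [stabilizerFactor, hv'.ne', hv', if_true, if_false, ← h v hv'.ne']
          generalize x v = a
          fin_cases a <;> simp [pauliZ]
      have := phase_mul_phase_flip G i x y hi h
      rw [hr, ← this]
      simp only [Finset.mem_singleton, if_true, plusProj, Matrix.of_apply, stabilizerFactor, hX,
        Matrix.one_apply_ne hxy]
      ring
  · push Not at h
    obtain ⟨v, hv, hxv⟩ := h
    have hxy : x ≠ y := fun hxy => hxv (congrFun hxy v)
    have h1 : ∏ v ∈ {i}ᶜ, (if v ∈ ({i} : Finset V) then plusProj else 1) (x v) (y v) = 0 :=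
      Finset.prod_eq_zero (i := v) (by simpa using hv) (by simp [hv, hxv])
    have h2 : ∏ v ∈ {i}ᶜ, stabilizerFactor G i v (x v) (y v) = 0 := by
      refine Finset.prod_eq_zero (i := v) (by simpa using hv) ?_
      simp only [stabilizerFactor, hv, if_false]
      split_ifs
      · revert hxv
        generalize x v = a, y v = b
        fin_cases a <;> fin_cases b <;> simp [pauliZ]
      · simp [hxv]
    rw [h1, h2, Matrix.one_apply_ne hxy]
    ring

theorem colorProjector_eq {k : ℕ} (C : G.Coloring (Fin k)) (l : Fin k) :
    colorProjector G C l = stabilizerProjector G (Finset.univ.filter fun i => C i = l) := by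
  have key : ∀ S : Finset V, S.noncommProd (fun i => (2⁻¹ : ℂ) • (stabilizer G i + 1))
      (stabilizer_projector_pairwise G _) = stabilizerProjector G S := by
    intro S
    induction S using Finset.induction_on with
    | empty => rw [stabilizerProjector_empty, Finset.noncommProd_empty]
    | insert i S hi ih =>
      rw [Finset.noncommProd_insert_of_notMem _ _ _ _ hi, ih, ← stabilizerProjector_singleton,
        stabilizerProjector_mul, Finset.insert_eq]
  exact key _

/-- The union bound for the commuting projectors `stabilizerProjector G (S l)`. -/
theorem posSemidef_sum_one_sub_stabilizerProjector {ι : Type*} [DecidableEq ι] (s : Finset ι)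
    (S : ι → Finset V) :
    (∑ l ∈ s, (1 - stabilizerProjector G (S l)) -
      (1 - stabilizerProjector G (s.biUnion S))).PosSemidef := by
  induction s using Finset.induction_on with
  | empty => simpa [stabilizerProjector_empty] using Matrix.PosSemidef.zero
  | insert l s hl ih =>
    set Q := stabilizerProjector G (S l) with hQ
    set R := stabilizerProjector G (s.biUnion S) with hR
    have hQR : stabilizerProjector G ((insert l s).biUnion S) = Q * R := by
      rw [Finset.biUnion_insert, hQ, hR, stabilizerProjector_mul]
    have hRQ : R * Q = Q * R := by
      rw [hQ, hR, stabilizerProjector_mul, stabilizerProjector_mul, Finset.union_comm]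
    have hQQ : Q * Q = Q := by rw [hQ, stabilizerProjector_mul, Finset.union_self]
    have hRR : R * R = R := by rw [hR, stabilizerProjector_mul, Finset.union_self]
    have hQh : Q.IsHermitian := isHermitian_stabilizerProjector G _
    have hRh : R.IsHermitian := isHermitian_stabilizerProjector G _
    -- `(1 - Q) + (1 - R) - (1 - Q * R) = (1 - Q) * (1 - R)`, a product of commuting projectors.
    have hpos : ((1 - Q) * (1 - R)).PosSemidef := by
      have hc : (1 - Q) * (1 - R) = (1 - R) * (1 - Q) := by
        simp only [mul_sub, sub_mul, hRQ, mul_one, one_mul]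
        abel
      refine posSemidef_of_isHermitian_of_mul_self ?_ ?_
      · rw [Matrix.IsHermitian, Matrix.conjTranspose_mul, Matrix.conjTranspose_sub,
          Matrix.conjTranspose_sub, hQh.eq, hRh.eq, Matrix.conjTranspose_one, hc]
      · have h1 : (1 - Q) * (1 - Q) = 1 - Q := by
          simp only [mul_sub, sub_mul, hQQ, mul_one, one_mul]; abel
        have h2 : (1 - R) * (1 - R) = 1 - R := by
          simp only [mul_sub, sub_mul, hRR, mul_one, one_mul]; abel
        calc (1 - Q) * (1 - R) * ((1 - Q) * (1 - R))
            = (1 - Q) * ((1 - R) * (1 - Q)) * (1 - R) := by simp only [mul_assoc]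
          _ = (1 - Q) * (1 - Q) * ((1 - R) * (1 - R)) := by rw [← hc]; simp only [mul_assoc]
          _ = _ := by rw [h1, h2]
    convert ih.add hpos using 1
    rw [Finset.sum_insert hl, hQR]
    simp only [mul_sub, sub_mul, mul_one, one_mul]
    abel

end Projectors

/-! ### Splitting configurations across a bipartition -/

section Glue

variable {V : Type*} [DecidableEq V] (A : Finset V)

theorem glue_add (a a' : Config {v // v ∈ A}) (b b' : Config {v // v ∉ A}) :
    glue A (a + a') (b + b') = glue A a b + glue A a' b' := by
  ext1 v
  by_cases h : v ∈ A <;> simp [glue, h]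

theorem glue_zero : glue A 0 0 = 0 := by
  ext1 v
  simp [glue]

theorem sum_config_eq_sum_glue [Fintype V] {M : Type*} [AddCommMonoid M] (f : Config V → M) :
    ∑ x, f x = ∑ a, ∑ b, f (glue A a b) := by
  rw [← Fintype.sum_prod_type']
  exact ((Equiv.piEquivPiSubtypeProd (· ∈ A) fun _ => Fin 2).symm.sum_comp f).symm

end Glue

/-! ### Entropy of a flat spectrum -/

section Entropy

/-- A positive multiple `c` of a projector, of trace one, has entropy `-log₂ c`. -/
theorem two_rpow_neg_vonNeumannEntropy {n : Type*} [Fintype n] [DecidableEq n]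
    {ρ : Matrix n n ℂ} {c : ℝ} (hρ : ρ.IsHermitian) (hc : 0 < c) (hsq : ρ * ρ = c • ρ)
    (htr : ρ.trace = 1) : (2 : ℝ) ^ (-vonNeumannEntropy ρ) = c := by
  have hsa : IsSelfAdjoint ρ := hρ
  -- The spectrum lies in `{0, c}`, where the two functions agree; at `0` the convention
  -- `0 log 0 = 0` enters.
  have hspec : ∀ t ∈ spectrum ℝ ρ, t * Real.logb 2 t = t * Real.logb 2 c := by
    intro t ht
    have hzero : cfc (fun t : ℝ => t * t - c * t) ρ = 0 := by
      rw [cfc_sub .., cfc_mul .., cfc_const_mul .., cfc_id' .., hsq, sub_self]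
    have h0 : t * t - c * t = 0 := by
      have := cfc_map_spectrum (R := ℝ) (fun t : ℝ => t * t - c * t) ρ
      rw [hzero] at this
      have hmem : t * t - c * t ∈ spectrum ℝ (0 : Matrix n n ℂ) := this ▸ ⟨t, ht, rfl⟩
      by_contra hne
      refine hmem ?_
      rw [spectrum.mem_resolventSet_iff, sub_zero]
      exact (IsUnit.mk0 _ hne).map (algebraMap ℝ (Matrix n n ℂ))
    have : t * (t - c) = 0 := by linarith
    rcases mul_eq_zero.mp this with h | h
    · simp [h]
    · rw [sub_eq_zero.mp h]
  -- The logarithm is discontinuous at `0`, but the spectrum is finite, hence discrete.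
  have hfin : (spectrum ℝ ρ).Finite := Matrix.finite_real_spectrum
  have hcont : ContinuousOn (Real.logb 2) (spectrum ℝ ρ) := hfin.continuousOn _
  have hmul : ρ * cfc (Real.logb 2) ρ = Real.logb 2 c • ρ := by
    calc ρ * cfc (Real.logb 2) ρ = cfc (fun t : ℝ => t) ρ * cfc (Real.logb 2) ρ := by
          rw [cfc_id' ..]
      _ = cfc (fun t : ℝ => t * Real.logb 2 t) ρ := by rw [← cfc_mul ..]
      _ = cfc (fun t : ℝ => Real.logb 2 c * t) ρ :=
          cfc_congr fun t ht => (hspec t ht).trans (mul_comm _ _)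
      _ = Real.logb 2 c • ρ := by rw [cfc_const_mul .., cfc_id' ..]
  rw [vonNeumannEntropy, hmul, neg_neg, Matrix.trace_smul, htr]
  simp [Real.rpow_logb, hc]

end Entropy

/-! ### The reduced density matrices of a graph state -/

section Flat

variable {V : Type*} [Fintype V] [DecidableEq V] (G : SimpleGraph V) [DecidableRel G.Adj]
  (A : Finset V)

/-- The sign `(-1)^{a Γ b}`, where `Γ` is the block of the adjacency matrix of `G` given by the edges
between `A` and its complement, as a character of the configurations `b` outside `A`. -/
def crossChar (a : Config {v // v ∈ A}) : AddChar (Config {v // v ∉ A}) ℂ where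
  toFun b := phase G (glue A a 0) * phase G (glue A 0 b) * phase G (glue A a b)
  map_zero_eq_one' := by
    rw [glue_zero, phase_zero, mul_one, phase_mul_self]
  map_add_eq_mul' b b' := by
    have h1 : glue A a 0 + glue A 0 b = glue A a b := by rw [← glue_add, add_zero, zero_add]
    have h2 : glue A a 0 + glue A 0 b' = glue A a b' := by rw [← glue_add, add_zero, zero_add]
    have h3 : glue A 0 b + glue A 0 b' = glue A 0 (b + b') := by rw [← glue_add, add_zero]
    have h4 : glue A a b + glue A 0 b' = glue A a (b + b') := by rw [← glue_add, add_zero]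
    have h := phase_add_add G (glue A a 0) (glue A 0 b) (glue A 0 b')
    rw [h1, h2, h3, h4] at h
    have e1 := phase_mul_self G (glue A a 0)
    have e2 := phase_mul_self G (glue A 0 b)
    have e3 := phase_mul_self G (glue A 0 b')
    have e4 := phase_mul_self G (glue A 0 (b + b'))
    generalize phase G (glue A a 0) = p, phase G (glue A 0 b) = q, phase G (glue A 0 b') = r,
      phase G (glue A 0 (b + b')) = s, phase G (glue A a b) = t, phase G (glue A a b') = u,
      phase G (glue A a (b + b')) = w at *
    -- The signs square to one, so the cocycle identity `h` can be solved for `w`.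
    have hw : w = p * q * r * t * u * s := by
      linear_combination (p * q * r) * h - w * (p * p * q * q * e3 + p * p * e2 + e1)
    rw [hw]
    linear_combination p ^ 2 * q * r * t * u * e4

theorem crossChar_apply (a : Config {v // v ∈ A}) (b : Config {v // v ∉ A}) :
    crossChar G A a b = phase G (glue A a 0) * phase G (glue A 0 b) * phase G (glue A a b) := rfl

/-- The phase splits into a factor on `A`, a factor outside `A`, and a bicharacter. -/
theorem phase_glue (a : Config {v // v ∈ A}) (b : Config {v // v ∉ A}) :
    phase G (glue A a b) = phase G (glue A a 0) * phase G (glue A 0 b) * crossChar G A a b := by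
  have e1 := phase_mul_self G (glue A a 0)
  have e2 := phase_mul_self G (glue A 0 b)
  rw [crossChar_apply]
  generalize phase G (glue A a 0) = p, phase G (glue A 0 b) = q, phase G (glue A a b) = t at *
  linear_combination -t * (p * p * e2 + e1)

theorem crossChar_add (a a' : Config {v // v ∈ A}) :
    crossChar G A (a + a') = crossChar G A a * crossChar G A a' := by
  ext b
  rw [AddChar.mul_apply]
  simp only [crossChar_apply]
  have h1 : glue A a 0 + glue A a' 0 = glue A (a + a') 0 := by rw [← glue_add, add_zero]
  have h2 : glue A a 0 + glue A 0 b = glue A a b := by rw [← glue_add, add_zero, zero_add]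
  have h3 : glue A a' 0 + glue A 0 b = glue A a' b := by rw [← glue_add, add_zero, zero_add]
  have h4 : glue A (a + a') 0 + glue A 0 b = glue A (a + a') b := by
    rw [← glue_add, add_zero, zero_add]
  have h := phase_add_add G (glue A a 0) (glue A a' 0) (glue A 0 b)
  rw [h1, h2, h3, h4] at h
  have e1 := phase_mul_self G (glue A a 0)
  have e2 := phase_mul_self G (glue A a' 0)
  have e3 := phase_mul_self G (glue A 0 b)
  have e4 := phase_mul_self G (glue A (a + a') 0)
  generalize phase G (glue A a 0) = p, phase G (glue A a' 0) = q, phase G (glue A 0 b) = r,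
    phase G (glue A (a + a') 0) = s, phase G (glue A a b) = t, phase G (glue A a' b) = u,
    phase G (glue A (a + a') b) = w at *
  -- The signs square to one, so the cocycle identity `h` can be solved for `w`.
  have hw : w = p * q * r * s * t * u := by
    linear_combination (p * q * r) * h - w * (p * p * q * q * e3 + p * p * e2 + e1)
  rw [hw]
  linear_combination p * q * r ^ 2 * t * u * e4

theorem config_add_self {W : Type*} (a : Config W) : a + a = 0 := by
  ext1 v
  simp only [Pi.add_apply, Pi.zero_apply]
  generalize a v = t
  revert t
  decide

open scoped Classical in
/-- The configurations `a` of `A` for which the character `crossChar G A a` is trivial: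
the kernel, over the field with two elements, of the block of the adjacency matrix between `A` and its
complement. -/
def crossKernel : Finset (Config {v // v ∈ A}) :=
  Finset.univ.filter fun a => crossChar G A a = 1

theorem mem_crossKernel {a : Config {v // v ∈ A}} :
    a ∈ crossKernel G A ↔ crossChar G A a = 1 := by
  simp [crossKernel]

theorem crossKernel_add_mem_iff {a a' : Config {v // v ∈ A}} (h : a ∈ crossKernel G A) :
    a + a' ∈ crossKernel G A ↔ a' ∈ crossKernel G A := by
  rw [mem_crossKernel] at *
  rw [mem_crossKernel, crossChar_add, h, one_mul]

theorem crossKernel_nonempty : (crossKernel G A).Nonempty := by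
  refine ⟨0, ?_⟩
  have h := crossChar_add G A 0 0
  rw [add_zero, left_eq_mul] at h
  exact (mem_crossKernel G A).mpr h

/-- The nonzero eigenvalue of the reduced density matrix of the graph state on `A`. -/
def schmidtWeight : ℝ := (crossKernel G A).card / 2 ^ A.card

theorem schmidtWeight_pos : 0 < schmidtWeight G A := by
  have := (crossKernel_nonempty G A).card_pos
  unfold schmidtWeight
  positivity

/-- Summing the character `crossChar G A (a + a')` over the configurations outside `A` leaves only the
entries with `a + a'` in the kernel. -/
theorem reduced_graphState_apply (a a' : Config {v // v ∈ A}) :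
    reduced A (ketBra (graphState G)) a a' =
      if a + a' ∈ crossKernel G A then
        phase G (glue A a 0) * phase G (glue A a' 0) * (2⁻¹ : ℂ) ^ A.card
      else 0 := by
  have hterm : ∀ b, ketBra (graphState G) (glue A a b) (glue A a' b) =
      phase G (glue A a 0) * phase G (glue A a' 0) * (2⁻¹ : ℂ) ^ Fintype.card V *
        crossChar G A (a + a') b := by
    intro b
    rw [ketBra, Matrix.vecMulVec_apply, Pi.star_apply, graphState_mul_star, phase_glue G A a b,
      phase_glue G A a' b, crossChar_add, AddChar.mul_apply]
    linear_combination phase G (glue A a 0) * phase G (glue A a' 0) * (2⁻¹ : ℂ) ^ Fintype.card V *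
        crossChar G A a b * crossChar G A a' b * phase_mul_self G (glue A 0 b)
  have hcard : Fintype.card V = A.card + Fintype.card {v // v ∉ A} := by
    have := Fintype.card_subtype_compl (· ∈ A)
    have := Finset.card_le_univ A
    simp at *
    omega
  rw [reduced, Matrix.of_apply, Finset.sum_congr rfl fun b _ => hterm b, ← Finset.mul_sum,
    AddChar.sum_eq_ite, ← AddChar.one_eq_zero]
  by_cases h : a + a' ∈ crossKernel G A
  · rw [if_pos h, if_pos ((mem_crossKernel G A).mp h), hcard, pow_add, Fintype.card_fun,
      Fintype.card_fin, Nat.cast_pow]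
    have hone : (2⁻¹ : ℂ) ^ Fintype.card {v // v ∉ A} *
        ((2 : ℕ) : ℂ) ^ Fintype.card {v // v ∉ A} = 1 := by
      rw [← mul_pow]
      norm_num
    linear_combination
      phase G (glue A a 0) * phase G (glue A a' 0) * (2⁻¹ : ℂ) ^ A.card * hone
  · rw [if_neg h, if_neg (mt (mem_crossKernel G A).mpr h), mul_zero]

theorem isHermitian_reduced_graphState : (reduced A (ketBra (graphState G))).IsHermitian := by
  ext a a'
  rw [Matrix.conjTranspose_apply, reduced, Matrix.of_apply, Matrix.of_apply, star_sum]
  simp only [ketBra, Matrix.vecMulVec_apply, Pi.star_apply, star_mul', star_star]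
  exact Finset.sum_congr rfl fun b _ => mul_comm _ _

/-- The reduced density matrix is a multiple of a projector: the Schmidt spectrum of a graph state is
flat. -/
theorem reduced_graphState_mul_self :
    reduced A (ketBra (graphState G)) * reduced A (ketBra (graphState G)) =
      schmidtWeight G A • reduced A (ketBra (graphState G)) := by
  ext a c
  rw [Matrix.mul_apply, Matrix.smul_apply, Complex.real_smul]
  -- As `crossKernel` is a subgroup, both factors are nonzero precisely when `a + b` and `a + c` lie
  -- in it.
  have hac : ∀ b, (a + b) + (b + c) = a + c := by
    intro b
    rw [add_assoc, ← add_assoc b b c, config_add_self, zero_add]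
  have hterm : ∀ b, reduced A (ketBra (graphState G)) a b * reduced A (ketBra (graphState G)) b c =
      if a + b ∈ crossKernel G A then
        (2⁻¹ : ℂ) ^ A.card * reduced A (ketBra (graphState G)) a c else 0 := by
    intro b
    simp only [reduced_graphState_apply]
    by_cases h1 : a + b ∈ crossKernel G A
    · have h2 := crossKernel_add_mem_iff G A (a' := b + c) h1
      rw [hac] at h2
      rw [if_pos h1, if_pos h1]
      by_cases h3 : b + c ∈ crossKernel G A
      · rw [if_pos h3, if_pos (h2.mpr h3)]
        linear_combination phase G (glue A a 0) * phase G (glue A c 0) * ((2⁻¹ : ℂ) ^ A.card) ^ 2 *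
          phase_mul_self G (glue A b 0)
      · rw [if_neg h3, if_neg (mt h2.mp h3), mul_zero, mul_zero]
    · rw [if_neg h1, if_neg h1, zero_mul]
  have hcount : (Finset.univ.filter fun b => a + b ∈ crossKernel G A).card =
      (crossKernel G A).card :=
    Finset.card_bij (fun b _ => a + b) (by simp) (by simp) fun b hb =>
      ⟨a + b, by simpa [← add_assoc, config_add_self] using hb, by
        rw [← add_assoc, config_add_self, zero_add]⟩
  rw [Finset.sum_congr rfl fun b _ => hterm b, ← Finset.sum_filter, Finset.sum_const, hcount,
    nsmul_eq_mul, schmidtWeight]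
  push_cast
  rw [inv_pow]
  ring

theorem trace_reduced_graphState : (reduced A (ketBra (graphState G))).trace = 1 := by
  have h0 : (0 : Config {v // v ∈ A}) ∈ crossKernel G A := by
    obtain ⟨a, ha⟩ := crossKernel_nonempty G A
    rw [← crossKernel_add_mem_iff G A ha, add_zero]
    exact ha
  simp only [Matrix.trace, Matrix.diag_apply, reduced_graphState_apply, config_add_self, h0,
    if_true, phase_mul_self, one_mul, Finset.sum_const, Finset.card_univ, Fintype.card_fun,
    Fintype.card_fin, Fintype.card_coe, nsmul_eq_mul]
  rw [Nat.cast_pow, ← mul_pow]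
  norm_num

theorem entropyWeight_eq : entropyWeight G A = schmidtWeight G A :=
  two_rpow_neg_vonNeumannEntropy (isHermitian_reduced_graphState G A) (schmidtWeight_pos G A)
    (reduced_graphState_mul_self G A) (trace_reduced_graphState G A)

end Flat

/-! ### Overlaps with product vectors -/

section Overlap

variable {V : Type*} [Fintype V] [DecidableEq V] (G : SimpleGraph V) [DecidableRel G.Adj]

theorem star_dotProduct_self {n : Type*} [Fintype n] (v : n → ℂ) :
    star v ⬝ᵥ v = ((∑ i, ‖v i‖ ^ 2 : ℝ) : ℂ) := by
  push_cast
  exact Finset.sum_congr rfl fun i _ => Complex.conj_mul' (v i)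

theorem trace_mul_ketBra (M : QOp V) (ψ : QVec V) :
    (M * ketBra ψ).trace = star ψ ⬝ᵥ M.mulVec ψ := by
  rw [ketBra, Matrix.mul_vecMulVec, Matrix.trace_vecMulVec, dotProduct_comm]

theorem trace_ketBra_mul_ketBra (g ψ : QVec V) :
    (ketBra g * ketBra ψ).trace = ((‖star g ⬝ᵥ ψ‖ ^ 2 : ℝ) : ℂ) := by
  have h : star ψ ⬝ᵥ g = star (star g ⬝ᵥ ψ) := by
    rw [Matrix.star_dotProduct]
  rw [trace_mul_ketBra, ketBra, Matrix.vecMulVec_mulVec, dotProduct_smul, h,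
    op_smul_eq_mul]
  push_cast
  exact Complex.conj_mul' _

theorem reduced_ketBra_eq_mul_conjTranspose (A : Finset V) (g : QVec V) :
    reduced A (ketBra g) =
      (Matrix.of fun a b => g (glue A a b)) * (Matrix.of fun a b => g (glue A a b)).conjTranspose := by
  ext a a'
  simp [reduced, ketBra, Matrix.mul_apply, Matrix.vecMulVec_apply]

/-- `c I - ρ` is `c` times a projector when `ρ` is `c` times a projector. -/
theorem schmidtWeight_smul_one_sub_posSemidef (A : Finset V) :
    (schmidtWeight G A • 1 - reduced A (ketBra (graphState G))).PosSemidef := by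
  set c := schmidtWeight G A with hc
  set ρ := reduced A (ketBra (graphState G)) with hρ
  have hpos : 0 < c := schmidtWeight_pos G A
  have hherm : (c • 1 - ρ).IsHermitian := by
    rw [Matrix.IsHermitian, Matrix.conjTranspose_sub, Matrix.conjTranspose_smul,
      Matrix.conjTranspose_one, (isHermitian_reduced_graphState G A).eq, star_trivial]
  have hsq : (c • 1 - ρ).conjTranspose * (c • 1 - ρ) = c • (c • 1 - ρ) := by
    rw [hherm.eq, sub_mul, mul_sub, mul_sub, reduced_graphState_mul_self]
    simp only [smul_mul_assoc, mul_smul_comm, one_mul, mul_one, smul_sub]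
    abel
  have h := (Matrix.posSemidef_conjTranspose_mul_self (c • 1 - ρ)).smul (inv_nonneg.mpr hpos.le)
  rwa [hsq, smul_smul, inv_mul_cancel₀ hpos.ne', one_smul] at h

/-- The squared overlap of a graph state with a product vector across `A` is at most its largest
squared Schmidt coefficient across `A`. -/
theorem norm_overlap_sq_le (A : Finset V) {ψ : QVec V} (hψ : IsPureState ψ)
    (φ : QVec {v // v ∈ A}) (χ : QVec {v // v ∉ A})
    (h : ∀ x, ψ x = φ (fun v => x v) * χ (fun v => x v)) :
    ‖star (graphState G) ⬝ᵥ ψ‖ ^ 2 ≤ entropyWeight G A := by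
  set M : Matrix (Config {v // v ∈ A}) (Config {v // v ∉ A}) ℂ :=
    Matrix.of fun a b => graphState G (glue A a b) with hM
  have hglue : ∀ a b, ψ (glue A a b) = φ a * χ b := by
    intro a b
    rw [h]
    congr 2 <;> ext v <;> simp [glue, v.2]
  have hone : (∑ a, ‖φ a‖ ^ 2) * ∑ b, ‖χ b‖ ^ 2 = 1 := by
    rw [Finset.sum_mul_sum, ← hψ, sum_config_eq_sum_glue A]
    simp only [hglue, norm_mul, mul_pow]
  set w := M.conjTranspose.mulVec φ with hw
  have hov : star (graphState G) ⬝ᵥ ψ = ∑ b, w b * χ b := by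
    rw [dotProduct, sum_config_eq_sum_glue A, Finset.sum_comm]
    refine Finset.sum_congr rfl fun b _ => ?_
    rw [hw, Matrix.mulVec, dotProduct, Finset.sum_mul]
    refine Finset.sum_congr rfl fun a _ => ?_
    rw [hglue, hM, Matrix.conjTranspose_apply, Matrix.of_apply, Pi.star_apply]
    ring
  have hcs : ‖star (graphState G) ⬝ᵥ ψ‖ ^ 2 ≤ (∑ b, ‖w b‖ ^ 2) * ∑ b, ‖χ b‖ ^ 2 := by
    rw [hov]
    refine le_trans ?_ (Finset.sum_mul_sq_le_sq_mul_sq _ _ _)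
    refine pow_le_pow_left₀ (norm_nonneg _) ?_ 2
    simpa only [norm_mul] using norm_sum_le Finset.univ fun b => w b * χ b
  have hwsum : ∑ b, ‖w b‖ ^ 2 ≤ schmidtWeight G A * ∑ a, ‖φ a‖ ^ 2 := by
    have hp := (schmidtWeight_smul_one_sub_posSemidef G A).dotProduct_mulVec_nonneg φ
    have hww : star φ ⬝ᵥ (reduced A (ketBra (graphState G))).mulVec φ = star w ⬝ᵥ w := by
      rw [reduced_ketBra_eq_mul_conjTranspose, ← hM, ← Matrix.mulVec_mulVec, ← hw,
        Matrix.dotProduct_mulVec, hw, Matrix.star_mulVec, Matrix.conjTranspose_conjTranspose]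
    rw [Matrix.sub_mulVec, dotProduct_sub, hww, Matrix.smul_mulVec, Matrix.one_mulVec,
      dotProduct_smul, star_dotProduct_self, star_dotProduct_self, Complex.real_smul,
      ← Complex.ofReal_mul, ← Complex.ofReal_sub] at hp
    exact sub_nonneg.mp (Complex.zero_le_real.mp hp)
  rw [entropyWeight_eq]
  calc _ ≤ (∑ b, ‖w b‖ ^ 2) * ∑ b, ‖χ b‖ ^ 2 := hcs
    _ ≤ (schmidtWeight G A * ∑ a, ‖φ a‖ ^ 2) * ∑ b, ‖χ b‖ ^ 2 := by gcongr
    _ = schmidtWeight G A := by rw [mul_assoc, hone, mul_one]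

/-- A fully separable pure state factorizes across every bipartition of the subsystems. -/
theorem exists_factorization_of_mem_fullySeparablePure
    {P : Finpartition (Finset.univ : Finset V)} {ψ : QVec V} (hψ : ψ ∈ fullySeparablePure P)
    {A : Finset V} (hA : A ∈ bipartitionSides P) :
    ∃ (φ : QVec {v // v ∈ A}) (χ : QVec {v // v ∉ A}),
      ∀ x, ψ x = φ (fun v => x v) * χ (fun v => x v) := by
  obtain ⟨-, f, hf⟩ := hψ
  obtain ⟨-, -, -, T, hT, rfl⟩ := Finset.mem_filter.mp hA
  -- Each factor is evaluated on the configuration extended by zero to the other side.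
  refine ⟨fun a => ∏ B ∈ Finset.univ.filter (fun B : {B // B ∈ P.parts} => B.1 ∈ T),
      f B fun v => glue _ a 0 v,
    fun b => ∏ B ∈ Finset.univ.filter (fun B : {B // B ∈ P.parts} => ¬ B.1 ∈ T),
      f B fun v => glue _ 0 b v, fun x => ?_⟩
  rw [hf, ← Finset.prod_filter_mul_prod_filter_not Finset.univ
    (fun B : {B // B ∈ P.parts} => B.1 ∈ T)]
  congr 1
  · refine Finset.prod_congr rfl fun B hB => ?_
    have hB : B.1 ∈ T := (Finset.mem_filter.mp hB).2
    congr 1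
    ext1 v
    have hv : v.1 ∈ T.biUnion id := Finset.mem_biUnion.mpr ⟨B, hB, v.2⟩
    simp only [glue, dif_pos hv]
  · refine Finset.prod_congr rfl fun B hB => ?_
    have hB : B.1 ∉ T := (Finset.mem_filter.mp hB).2
    congr 1
    ext1 v
    have hv : v.1 ∉ T.biUnion id := by
      intro hv
      obtain ⟨D, hD, hvD⟩ := Finset.mem_biUnion.mp hv
      exact hB (P.eq_of_mem_parts B.2 (hT hD) v.2 hvD ▸ hD)
    simp only [glue, dif_neg hv]

end Overlap

/-! ### Expectation values of the witnesses -/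

section Witness

theorem biUnion_color {V : Type*} [Fintype V] [DecidableEq V] {G : SimpleGraph V} {k : ℕ}
    (C : G.Coloring (Fin k)) :
    (Finset.univ.biUnion fun l => Finset.univ.filter fun i => C i = l) = Finset.univ := by
  ext v
  simp

variable {V : Type*} [Fintype V] [DecidableEq V] (G : SimpleGraph V) [DecidableRel G.Adj]

/-- The witness dominates the projector witness `c I - |G⟩⟨G|`. -/
theorem posSemidef_witness_sub {k : ℕ} (C : G.Coloring (Fin k)) (c : ℝ) :
    (witness G C c - (c • (1 : QOp V) - ketBra (graphState G))).PosSemidef := by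
  have h := posSemidef_sum_one_sub_stabilizerProjector G Finset.univ
    fun l => Finset.univ.filter fun i => C i = l
  rw [biUnion_color, stabilizerProjector_univ] at h
  convert h using 1
  simp only [witness, colorProjector_eq, Finset.sum_sub_distrib, Finset.sum_const,
    Finset.card_univ, Fintype.card_fin, add_smul, sub_smul, one_smul, Nat.cast_smul_eq_nsmul]
  abel

theorem trace_witness_mul_ketBra_nonneg {k : ℕ} (C : G.Coloring (Fin k)) {c : ℝ} {ψ : QVec V}
    (hψ : IsPureState ψ) (h : ‖star (graphState G) ⬝ᵥ ψ‖ ^ 2 ≤ c) :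
    0 ≤ (witness G C c * ketBra ψ).trace := by
  have h1 := (posSemidef_witness_sub G C c).dotProduct_mulVec_nonneg ψ
  have h2 : 0 ≤ ((c • (1 : QOp V) - ketBra (graphState G)) * ketBra ψ).trace := by
    have hψ1 : (ketBra ψ).trace = 1 := by
      rw [ketBra, Matrix.trace_vecMulVec, dotProduct_comm, star_dotProduct_self, hψ,
        Complex.ofReal_one]
    rw [sub_mul, Matrix.trace_sub, trace_ketBra_mul_ketBra, smul_mul_assoc, one_mul,
      Matrix.trace_smul, hψ1, Complex.real_smul, mul_one, ← Complex.ofReal_sub]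
    exact Complex.zero_le_real.mpr (sub_nonneg.mpr h)
  rw [← trace_mul_ketBra, sub_mul, Matrix.trace_sub] at h1
  simpa using add_nonneg h1 h2

theorem trace_witness_mul_nonneg_of_isMixtureOf {k : ℕ} (C : G.Coloring (Fin k)) {c : ℝ}
    {S : Set (QVec V)}
    (hS : ∀ ψ ∈ S, IsPureState ψ ∧ ‖star (graphState G) ⬝ᵥ ψ‖ ^ 2 ≤ c) {ρ : QOp V}
    (hρ : IsMixtureOf S ρ) : 0 ≤ (witness G C c * ρ).trace := by
  obtain ⟨n, p, ψ, hp, -, hψ, rfl⟩ := hρ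
  rw [Matrix.mul_sum, Matrix.trace_sum]
  refine Finset.sum_nonneg fun i _ => ?_
  rw [mul_smul_comm, Matrix.trace_smul]
  exact smul_nonneg (hp i)
    (trace_witness_mul_ketBra_nonneg G C (hS _ (hψ i)).1 (hS _ (hψ i)).2)

theorem trace_ketBra_graphState : (ketBra (graphState G)).trace = 1 := by
  simp only [Matrix.trace, Matrix.diag_apply, ketBra, Matrix.vecMulVec_apply, Pi.star_apply,
    graphState_mul_star, phase_mul_self, one_mul, Finset.sum_const, Finset.card_univ,
    Fintype.card_fun, Fintype.card_fin, nsmul_eq_mul]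
  rw [Nat.cast_pow, ← mul_pow]
  norm_num

theorem trace_witness_mul_ketBra_graphState {k : ℕ} (C : G.Coloring (Fin k)) (c : ℝ) :
    (witness G C c * ketBra (graphState G)).trace = ((c - 1 : ℝ) : ℂ) := by
  rw [witness, sub_mul, Matrix.sum_mul, Matrix.trace_sub, Matrix.trace_sum, smul_mul_assoc,
    one_mul, Matrix.trace_smul, ← stabilizerProjector_univ]
  have hu : ∀ S : Finset V, S ∪ Finset.univ = Finset.univ := fun S =>
    Finset.union_eq_right.mpr (Finset.subset_univ S)
  simp only [colorProjector_eq, stabilizerProjector_mul, hu]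
  rw [stabilizerProjector_univ, trace_ketBra_graphState]
  simp only [Finset.sum_const, Finset.card_univ, Fintype.card_fin, nsmul_eq_mul,
    Complex.real_smul]
  push_cast
  ring

end Witness

/-! ### Connected graphs -/

section Connected

variable {V : Type*} [Fintype V] [DecidableEq V] (G : SimpleGraph V) [DecidableRel G.Adj]

theorem phase_eq_one_of_subsingleton {x : Config V} {i : V} (h : ∀ v, x v = 1 → v = i) :
    phase G x = 1 := by
  refine Finset.prod_eq_one fun e he => ?_
  induction e with | _ u v =>
  refine if_neg fun hx => ?_
  have huv : G.Adj u v := by simpa using he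
  exact huv.ne ((h u (hx u (Sym2.mem_mk_left u v))).trans
    (h v (hx v (Sym2.mem_mk_right u v))).symm)

theorem phase_eq_neg_one_of_adj {x : Config V} {i j : V} (hij : G.Adj i j)
    (h : ∀ v, x v = 1 ↔ v = i ∨ v = j) : phase G x = -1 := by
  rw [phase, Finset.prod_eq_single s(i, j)]
  · exact if_pos fun v hv => (h v).mpr (Sym2.mem_iff.mp hv)
  · intro e he hne
    induction e with | _ u v =>
    refine if_neg fun hx => hne ?_
    have huv : G.Adj u v := by simpa using he
    have hu := (h u).mp (hx u (Sym2.mem_mk_left u v))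
    have hv := (h v).mp (hx v (Sym2.mem_mk_right u v))
    rcases hu with rfl | rfl <;> rcases hv with rfl | rfl
    · exact absurd rfl huv.ne
    · rfl
    · exact Sym2.eq_swap
    · exact absurd rfl huv.ne
  · intro hne
    exact absurd (by simpa using hij) hne

/-- Connectedness provides an edge leaving `A`, so that `crossChar` is not trivial. -/
theorem entropyWeight_lt_one (hG : G.Connected) {A : Finset V} (h0 : A ≠ ∅)
    (h1 : A ≠ Finset.univ) : entropyWeight G A < 1 := by
  obtain ⟨u, hu⟩ := Finset.nonempty_iff_ne_empty.mpr h0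
  obtain ⟨w, hw⟩ : ∃ w, w ∉ A := by
    by_contra! h
    exact h1 (Finset.eq_univ_iff_forall.mpr h)
  obtain ⟨p⟩ := hG.preconnected u w
  obtain ⟨d, -, hi, hj⟩ := p.exists_boundary_dart (A : Set V) hu hw
  obtain ⟨⟨i, j⟩, hij⟩ := d
  simp only [Finset.mem_coe] at hi hj
  have hij : G.Adj i j := hij
  -- `a` and `b` excite exactly the two ends of the edge, so they see its sign and no other.
  set a : Config {v // v ∈ A} := fun v => if v.1 = i then 1 else 0 with ha
  set b : Config {v // v ∉ A} := fun v => if v.1 = j then 1 else 0 with hb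
  have hphase_a : phase G (glue A a 0) = 1 := by
    refine phase_eq_one_of_subsingleton G (i := i) fun v hv => ?_
    by_cases hvA : v ∈ A
    · simpa [glue, hvA, ha] using hv
    · simp [glue, hvA] at hv
  have hphase_b : phase G (glue A 0 b) = 1 := by
    refine phase_eq_one_of_subsingleton G (i := j) fun v hv => ?_
    by_cases hvA : v ∈ A
    · simp [glue, hvA] at hv
    · simpa [glue, hvA, hb] using hv
  have hphase_ab : phase G (glue A a b) = -1 := by
    refine phase_eq_neg_one_of_adj G hij fun v => ?_
    by_cases hvA : v ∈ A
    · have hvj : v ≠ j := fun h => hj (h ▸ hvA)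
      simp [glue, hvA, ha, hvj]
    · have hvi : v ≠ i := fun h => hvA (h ▸ hi)
      simp [glue, hvA, hb, hvi]
  have hnot : a ∉ crossKernel G A := by
    rw [mem_crossKernel]
    intro h
    have := DFunLike.congr_fun h b
    rw [crossChar_apply, hphase_a, hphase_b, hphase_ab, AddChar.one_apply] at this
    norm_num at this
  have hlt : (crossKernel G A).card < 2 ^ A.card := by
    have h := Finset.card_lt_univ_of_notMem hnot
    simpa using h
  rw [entropyWeight_eq, schmidtWeight, div_lt_one (by positivity)]
  exact_mod_cast hlt

end Connected

end GraphWitness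

end

theorem theorem1 {V : Type*} [Fintype V] [DecidableEq V]
    (G : SimpleGraph V) [DecidableRel G.Adj] {k : ℕ} (C : G.Coloring (Fin k))
    (P : Finpartition (Finset.univ : Finset V)) (hP : 2 ≤ P.parts.card) :
    ((∀ ρ : GraphWitness.QOp V, GraphWitness.IsFullySeparable P ρ →
        0 ≤ (GraphWitness.witness G C (GraphWitness.minWeight P G hP) * ρ).trace) ∧
      (∀ ρ : GraphWitness.QOp V, GraphWitness.IsBiSeparable P ρ →
        0 ≤ (GraphWitness.witness G C (GraphWitness.maxWeight P G hP) * ρ).trace)) ∧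
    (G.Connected →
      (GraphWitness.witness G C (GraphWitness.minWeight P G hP) *
          GraphWitness.ketBra (GraphWitness.graphState G)).trace < 0 ∧
      (GraphWitness.witness G C (GraphWitness.maxWeight P G hP) *
          GraphWitness.ketBra (GraphWitness.graphState G)).trace < 0) := by
  open GraphWitness in
  refine ⟨⟨fun ρ hρ => ?_, fun ρ hρ => ?_⟩, fun hG => ?_⟩
  · refine trace_witness_mul_nonneg_of_isMixtureOf G C (fun ψ hψ => ⟨hψ.1, ?_⟩) hρ
    refine Finset.le_inf' _ _ fun A hA => ?_
    obtain ⟨φ, χ, h⟩ := exists_factorization_of_mem_fullySeparablePure hψ hA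
    exact norm_overlap_sq_le G A hψ.1 φ χ h
  · refine trace_witness_mul_nonneg_of_isMixtureOf G C (fun ψ hψ => ⟨hψ.1, ?_⟩) hρ
    obtain ⟨hpure, A, hA, φ, χ, h⟩ := hψ
    exact (norm_overlap_sq_le G A hpure φ χ h).trans (Finset.le_sup' (entropyWeight G) hA)
  · have hlt : ∀ A ∈ bipartitionSides P, entropyWeight G A < 1 := fun A hA =>
      entropyWeight_lt_one G hG (Finset.mem_filter.mp hA).2.1 (Finset.mem_filter.mp hA).2.2.1
    have hneg : ∀ c : ℝ, c < 1 → (witness G C c * ketBra (graphState G)).trace < 0 := by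
      intro c hc
      rw [trace_witness_mul_ketBra_graphState, ← Complex.ofReal_zero, Complex.real_lt_real]
      linarith
    obtain ⟨A, hA⟩ := bipartitionSides_nonempty P hP
    exact ⟨hneg _ ((Finset.inf'_le (entropyWeight G) hA).trans_lt (hlt A hA)),
      hneg _ ((Finset.sup'_lt_iff _).mpr hlt)⟩
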